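/- Fix a nonprincipal ultrafilter $\mathcal V$ on $\mathbb N$; for a set $A$ let ${}^*A=A^{\mathbb N}/\mathcal V$ be its ultrapower. Let $\mu\in\mathbb C\setminus\mathbb R$, $\Lambda_\mu=\mathbb Z\mu+\mathbb Z$ and ${}^*\Lambda_\mu\subset{}^*\mathbb C$ its ultrapower. Let $D$ be the set of hyperfinite subsets $[F_i]$ of ${}^*\mathbb Z^2$ (ultraproducts of finite sets $F_i\subset\mathbb Z^2$), directed by inclusion, and let $\mathsf{Cone}(D)$ be the set of ultrafilters on $D$ containing all cones $\{F'\in D: F\subset F'\}$, $F\in D$. For an ultrafilter $\mathfrak u$ on $D$ let ${}^\diamond\mathbb C_{\mathfrak u}$ and ${}^\diamond\mathbb R_{\mathfrak u}$ be the ultrapowers of ${}^*\mathbb C$ and ${}^*\mathbb R$ with respect to $\mathfrak u$, which contain ${}^*\mathbb C$, ${}^*\mathbb R$ as classes of constant nets. Let ${}^\diamond\check\Gamma$ be the algebra of sections $\mathfrak u\mapsto f(\mathfrak u)\in{}^\diamond\mathbb C_{\mathfrak u}$ over all ultrafilters on $D$, ${}^\diamond\check\Gamma^{\rm cone}$ the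 algebra of sections over $\mathsf{Cone}(D)$, and ${}^\diamond\check\Gamma\cup\{\infty\}$, ${}^\diamond\check\Gamma^{\rm cone}\cup\{\infty\}$ the sets of sections with values in ${}^\diamond\mathbb C_{\mathfrak u}\cup\{\infty\}$. A net $(x_F)_{F\in D}$ in ${}^*\mathbb C$ (in ${}^*\mathbb C\cup\{\infty\}$) defines such a section, whose value at $\mathfrak u$ is its class modulo $\mathfrak u$. For $f,g\in{}^\diamond\check\Gamma^{\rm cone}$ write $f\simeq_* g$ if $|f(\mathfrak u)-g(\mathfrak u)|<\epsilon$ in ${}^\diamond\mathbb R_{\mathfrak u}$ for every positive $\epsilon\in{}^*\mathbb R$ and every $\mathfrak u\in\mathsf{Cone}(D)$. An automorphism $\sigma$ of the directed set $D$ acts on sections over $\mathsf{Cone}(D)$: $(\sigma\cdot f)(\mathfrak u)$ is the class modulo $\mathfrak u$ of $(x_{\sigma F})_F$, where $(x_F)_F$ is a net representing $f(\sigma\mathfrak u)$. In this way ${}^*\mathbb Z^2$ acts, by $F\mapsto F+p$, and $\mathrm{GL}(2,\mathbb Z)$ acts, by $F\mapsto AF$; let $\mathcal G$ be the group generated by both.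 Let ${}^\diamond\hat\Gamma^{\rm class}={}^\diamond\check\Gamma^{\rm cone}/\mathcal G$, with projection $\pi$ and with the relation $\simeq_*$ induced from ${}^\diamond\check\Gamma^{\rm cone}$ ($x\simeq_* y$ if $f\simeq_* g$ for some representatives $f$ of $x$ and $g$ of $y$). Let ${}^\diamond g_1,{}^\diamond g_2,{}^\diamond g_3\in{}^\diamond\check\Gamma$ be the sections defined by the nets of hyperfinite sums $$\sum_{(m,n)\in F\setminus\{(0,0)\}}(m\mu+n)^{-2},\qquad 60\sum_{(m,n)\in F\setminus\{(0,0)\}}(m\mu+n)^{-4},\qquad 140\sum_{(m,n)\in F\setminus\{(0,0)\}}(m\mu+n)^{-6}.$$ For $z\in{}^*\mathbb C$ let ${}^\diamond\check\wp^{\rm nc}(z),({}^\diamond\check\wp^{\rm nc})'(z)\in{}^\diamond\check\Gamma\cup\{\infty\}$ be the sections defined by the net $\wp^{\rm nc}_F(z)=\sum_{(m,n)\in F}(z-(m\mu+n))^{-2}$ and the net $(\wp^{\rm nc}_F)'(z)$ of its (internal) derivatives in $z$, the $F$-component being $\infty$ if $z=m\mu+n$ for some $(m,n)\in F$. Restricted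 to $\mathsf{Cone}(D)$ and taken modulo the action of ${}^*\mathbb Z^2$, these depend only on the class $t$ of $z$ in ${}^*\mathbb T_\mu={}^*\mathbb C/{}^*\Lambda_\mu$; denote the resulting classes by ${}^\diamond\hat\wp^{\rm nc}(t)$, $({}^\diamond\hat\wp^{\rm nc})'(t)$. Put $$E(a_1,a_2,a_3;X,Y)=Y^2-4X^3+12a_1X^2-(12a_1^2-a_2)X+(4a_1^3-a_1a_2+a_3).$$ **Theorem.** For every $t\in{}^*\mathbb T_\mu$, $t\neq0$, the pair $({}^\diamond\hat\wp^{\rm nc}(t),({}^\diamond\hat\wp^{\rm nc})'(t))$ over $\mathsf{Cone}(D)$ is a solution of the $*$-infinitesimal Weierstrass equation ${}^\diamond E^{\rm class}_\mu(X,Y)\simeq_*0$ in ${}^\diamond\hat\Gamma^{\rm class}$, in the following sense. Both classes have representatives in ${}^\diamond\check\Gamma^{\rm cone}$, i.e. without the value $\infty$; and if $\sigma\in\mathcal G$ and $X,Y,a_1,a_2,a_3\in{}^\diamond\check\Gamma^{\rm cone}$ are such that $\sigma\cdot X$, $\sigma\cdot Y$ represent ${}^\diamond\hat\wp^{\rm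 nc}(t)$, $({}^\diamond\hat\wp^{\rm nc})'(t)$ and each $\sigma\cdot a_k$ is equal, modulo ${}^*\mathbb Z^2$, to ${}^\diamond g_k|_{\mathsf{Cone}(D)}$, then $$\pi\big(E(a_1,a_2,a_3;X,Y)\big)\simeq_*0 .$$ -/

import Mathlib

open Filter OnePoint

noncomputable section

namespace UltraWeierstrass

/-- The index lattice `ℤ²`; the pair `(m, n)` is `![m, n]`. -/
abbrev Z2 : Type := Fin 2 → ℤ

/-! ### Ultrapowers over `ℕ` and hyperfinite sets -/

/-- The ultrapower `*α` of `α` with respect to an ultrafilter `𝒱` on `ℕ`. -/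
abbrev Hyper (𝒱 : Ultrafilter ℕ) (α : Type) : Type := Germ (𝒱 : Filter ℕ) α

/-- The hyperfinite subsets `[F_i]` of `*ℤ²`, given as classes of sequences of finite subsets of
`ℤ²`. The order is `[F_i] ≤ [F'_i]` iff `F_i ⊆ F'_i` for `𝒱`-almost all `i`; by
`carrier_subset_iff` and `carrier_injective` this is the set of hyperfinite subsets with the
inclusion order. -/
abbrev Hyperfinite (𝒱 : Ultrafilter ℕ) : Type := Hyper 𝒱 (Finset Z2)

/-- The subset of `*ℤ²` given by a hyperfinite set. -/
def carrier {𝒱 : Ultrafilter ℕ} (F : Hyperfinite 𝒱) : Set (Hyper 𝒱 Z2) :=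
  {p | Germ.LiftRel (fun v S => v ∈ S) p F}

theorem carrier_subset_iff {𝒱 : Ultrafilter ℕ} (F F' : Hyperfinite 𝒱) :
    carrier F ⊆ carrier F' ↔ F ≤ F' := by
  induction F using Germ.inductionOn with | _ F => ?_
  induction F' using Germ.inductionOn with | _ F' => ?_
  constructor
  · intro h
    rw [Germ.coe_le]
    by_contra hc
    have hc' : ∀ᶠ i in (𝒱 : Filter ℕ), ¬ F i ≤ F' i :=
      Ultrafilter.eventually_not.2 hc
    have key : ∀ i, ∃ v, ¬ F i ≤ F' i → v ∈ F i ∧ v ∉ F' i := by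
      intro i
      by_cases hi : F i ≤ F' i
      · exact ⟨0, fun hn => absurd hi hn⟩
      · obtain ⟨v, hv⟩ := Finset.not_subset.1 hi
        exact ⟨v, fun _ => hv⟩
    choose v hv using key
    have h1 : ((v : ℕ → Z2) : Hyper 𝒱 Z2) ∈ carrier (F : Hyperfinite 𝒱) :=
      Germ.liftRel_coe.2 (hc'.mono fun i hi => (hv i hi).1)
    have h2 := Germ.liftRel_coe.1 (h h1)
    obtain ⟨i, hi, hi'⟩ := (hc'.and h2).exists
    exact (hv i hi).2 hi'
  · intro h p hp
    induction p using Germ.inductionOn with | _ p => ?_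
    exact Germ.liftRel_coe.2 (((Germ.coe_le.1 h).and (Germ.liftRel_coe.1 hp)).mono
      fun i hi => hi.1 hi.2)

theorem carrier_injective {𝒱 : Ultrafilter ℕ} :
    Function.Injective (carrier (𝒱 := 𝒱)) := fun F F' h =>
  le_antisymm ((carrier_subset_iff F F').1 h.le) ((carrier_subset_iff F' F).1 h.ge)

/-- A class `[e_i]` of permutations of `ℤ²` acts on hyperfinite subsets by direct images. -/
def internalPerm {𝒱 : Ultrafilter ℕ} (e : Hyper 𝒱 (Equiv.Perm Z2)) :
    Hyperfinite 𝒱 ≃o Hyperfinite 𝒱 where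
  toFun F := Germ.map₂ (fun (e : Equiv.Perm Z2) S => S.map e.toEmbedding) e F
  invFun F := Germ.map₂ (fun (e : Equiv.Perm Z2) S => S.map e.symm.toEmbedding) e F
  left_inv F := by
    induction e using Germ.inductionOn with | _ e => ?_
    induction F using Germ.inductionOn with | _ F => ?_
    refine Germ.coe_eq.2 (Eventually.of_forall fun i => ?_)
    ext v; simp
  right_inv F := by
    induction e using Germ.inductionOn with | _ e => ?_
    induction F using Germ.inductionOn with | _ F => ?_
    refine Germ.coe_eq.2 (Eventually.of_forall fun i => ?_)
    ext v; simp
  map_rel_iff' {F F'} := by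
    induction e using Germ.inductionOn with | _ e => ?_
    induction F using Germ.inductionOn with | _ F => ?_
    induction F' using Germ.inductionOn with | _ F' => ?_
    change ((fun i => (F i).map (e i).toEmbedding : ℕ → Finset Z2) : Hyperfinite 𝒱) ≤
      ((fun i => (F' i).map (e i).toEmbedding : ℕ → Finset Z2) : Hyperfinite 𝒱) ↔ _
    rw [Germ.coe_le, Germ.coe_le]
    exact eventually_congr (Eventually.of_forall fun i => Finset.map_subset_map)

/-- Translation `F ↦ F + p` of hyperfinite sets by `p ∈ *ℤ²`. -/
def translate {𝒱 : Ultrafilter ℕ} (p : Hyper 𝒱 Z2) : Hyperfinite 𝒱 ≃o Hyperfinite 𝒱 :=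
  internalPerm (p.map fun v => Equiv.addRight v)

/-- A matrix in `GL(2, ℤ)` as a permutation of `ℤ²`. -/
def matrixPerm (A : GL (Fin 2) ℤ) : Equiv.Perm Z2 where
  toFun v := (A : Matrix (Fin 2) (Fin 2) ℤ).mulVec v
  invFun v := ((A⁻¹ : GL (Fin 2) ℤ) : Matrix (Fin 2) (Fin 2) ℤ).mulVec v
  left_inv v := by
    beta_reduce
    rw [Matrix.mulVec_mulVec, ← Units.val_mul]; simp
  right_inv v := by
    beta_reduce
    rw [Matrix.mulVec_mulVec, ← Units.val_mul]; simp

/-- The action `F ↦ A F` of `GL(2, ℤ)` on hyperfinite sets. -/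
def linear {𝒱 : Ultrafilter ℕ} (A : GL (Fin 2) ℤ) : Hyperfinite 𝒱 ≃o Hyperfinite 𝒱 :=
  internalPerm (Germ.const (matrixPerm A))

/-- The group generated by the translations by elements of `*ℤ²`. -/
def transGroup (𝒱 : Ultrafilter ℕ) : Subgroup (Hyperfinite 𝒱 ≃o Hyperfinite 𝒱) :=
  Subgroup.closure (Set.range translate)

/-- The group generated by the translations by `*ℤ²` and by `GL(2, ℤ)`. -/
def fullGroup (𝒱 : Ultrafilter ℕ) : Subgroup (Hyperfinite 𝒱 ≃o Hyperfinite 𝒱) :=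
  Subgroup.closure (Set.range translate ∪ Set.range linear)

/-! ### The diamond sheaf over the Stone space, its sections over the cone ultrafilters -/

/-- The cone ultrafilters on the directed set of hyperfinite sets. The filter generated by the
cones `{F' | F ≤ F'}` is `Filter.atTop`. -/
abbrev Cone (𝒱 : Ultrafilter ℕ) : Type :=
  {u : Ultrafilter (Hyperfinite 𝒱) // (u : Filter (Hyperfinite 𝒱)) ≤ atTop}

/-- The fibre over `u` of the sheaf `◇ℂ`: the ultrapower of `*ℂ` with respect to `u`. -/
abbrev Fibre (𝒱 : Ultrafilter ℕ) (u : Ultrafilter (Hyperfinite 𝒱)) : Type :=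
  Germ (u : Filter (Hyperfinite 𝒱)) (Hyper 𝒱 ℂ)

/-- The algebra of set-theoretic sections over the whole space of ultrafilters. -/
abbrev Section (𝒱 : Ultrafilter ℕ) : Type :=
  (u : Ultrafilter (Hyperfinite 𝒱)) → Fibre 𝒱 u

/-- Sections of the sphere sheaf, with fibres `◇ℂ_u ∪ {∞}`. -/
abbrev SphereSection (𝒱 : Ultrafilter ℕ) : Type :=
  (u : Ultrafilter (Hyperfinite 𝒱)) → OnePoint (Fibre 𝒱 u)

/-- The algebra of sections over the cone ultrafilters. -/
abbrev ConeSection (𝒱 : Ultrafilter ℕ) : Type := (u : Cone 𝒱) → Fibre 𝒱 u.1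

/-- Sections of the sphere sheaf over the cone ultrafilters. -/
abbrev ConeSphereSection (𝒱 : Ultrafilter ℕ) : Type := (u : Cone 𝒱) → OnePoint (Fibre 𝒱 u.1)

/-- Restriction of sections to the cone ultrafilters. -/
def Section.restrict {𝒱 : Ultrafilter ℕ} (f : Section 𝒱) : ConeSection 𝒱 := fun u => f u.1

/-- Restriction of sphere sections to the cone ultrafilters. -/
def SphereSection.restrict {𝒱 : Ultrafilter ℕ} (f : SphereSection 𝒱) : ConeSphereSection 𝒱 :=
  fun u => f u.1

/-- A finite-valued section, as a sphere section. -/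
def ConeSection.toSphere {𝒱 : Ultrafilter ℕ} (f : ConeSection 𝒱) : ConeSphereSection 𝒱 :=
  fun u => (f u : OnePoint (Fibre 𝒱 u.1))

/-- The section defined by a net in `*ℂ` indexed by hyperfinite sets. -/
def ofNet {𝒱 : Ultrafilter ℕ} (x : Hyperfinite 𝒱 → Hyper 𝒱 ℂ) : Section 𝒱 :=
  fun u => (x : Germ (u : Filter (Hyperfinite 𝒱)) (Hyper 𝒱 ℂ))

open Classical in
/-- The sphere section defined by a net in `*ℂ ∪ {∞}`: its value at `u` is `∞` if the net is
`u`-almost everywhere `∞`, and otherwise (the net being finite `u`-almost everywhere) the class of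
its finite values. -/
def ofSphereNet {𝒱 : Ultrafilter ℕ} (x : Hyperfinite 𝒱 → OnePoint (Hyper 𝒱 ℂ)) :
    SphereSection 𝒱 := fun u =>
  if ∀ᶠ F in (u : Filter (Hyperfinite 𝒱)), x F = ∞ then ∞
  else (((fun F => (x F).elim 0 id : Hyperfinite 𝒱 → Hyper 𝒱 ℂ) : Fibre 𝒱 u) :
    OnePoint (Fibre 𝒱 u))

/-- The action of an automorphism of the index set on the cone ultrafilters. -/
def Cone.shift {𝒱 : Ultrafilter ℕ} (σ : Hyperfinite 𝒱 ≃o Hyperfinite 𝒱) (u : Cone 𝒱) :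
    Cone 𝒱 :=
  ⟨u.1.map σ, (Filter.map_mono u.2).trans σ.tendsto_atTop⟩

/-- The shift of net classes, from the fibre over `σ u` to the fibre over `u`: the class of the
net `(x_F)` goes to the class of `(x_{σ F})`. -/
def fibreShift {𝒱 : Ultrafilter ℕ} (σ : Hyperfinite 𝒱 ≃o Hyperfinite 𝒱) (u : Cone 𝒱)
    (x : Fibre 𝒱 (u.shift σ).1) : Fibre 𝒱 u.1 :=
  x.compTendsto σ tendsto_map

/-- The induced (diagonal) action on cone sections: `(σ · f)(u) = σ · f(σ u)`. -/
def ConeSection.shift {𝒱 : Ultrafilter ℕ} (σ : Hyperfinite 𝒱 ≃o Hyperfinite 𝒱)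
    (f : ConeSection 𝒱) : ConeSection 𝒱 := fun u => fibreShift σ u (f (u.shift σ))

/-- The diagonal action on cone sphere sections (fixing `∞`). -/
def ConeSphereSection.shift {𝒱 : Ultrafilter ℕ} (σ : Hyperfinite 𝒱 ≃o Hyperfinite 𝒱)
    (f : ConeSphereSection 𝒱) : ConeSphereSection 𝒱 :=
  fun u => (f (u.shift σ)).map (fibreShift σ u)

theorem Cone.shift_one {𝒱 : Ultrafilter ℕ} (u : Cone 𝒱) : u.shift 1 = u :=
  Subtype.ext (Ultrafilter.map_id u.1)

theorem Cone.shift_mul {𝒱 : Ultrafilter ℕ} (σ τ : Hyperfinite 𝒱 ≃o Hyperfinite 𝒱)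
    (u : Cone 𝒱) : u.shift (σ * τ) = (u.shift τ).shift σ :=
  Subtype.ext (Ultrafilter.map_map (f := u.1) τ σ).symm

theorem ConeSphereSection.exists_rep {𝒱 : Ultrafilter ℕ} (f : ConeSphereSection 𝒱) :
    ∃ r : Cone 𝒱 → OnePoint (Hyperfinite 𝒱 → Hyper 𝒱 ℂ),
      f = fun u => (r u).map (Germ.ofFun : _ → Fibre 𝒱 u.1) := by
  have : ∀ u, ∃ r : OnePoint (Hyperfinite 𝒱 → Hyper 𝒱 ℂ),
      f u = r.map (Germ.ofFun : _ → Fibre 𝒱 u.1) := by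
    intro u
    induction f u using OnePoint.rec with
    | infty => exact ⟨∞, rfl⟩
    | coe x =>
      induction x using Germ.inductionOn with | _ x => ?_
      exact ⟨(x : OnePoint (Hyperfinite 𝒱 → Hyper 𝒱 ℂ)), rfl⟩
  choose r hr using this
  exact ⟨r, funext hr⟩

theorem ConeSphereSection.shift_rep {𝒱 : Ultrafilter ℕ} (σ : Hyperfinite 𝒱 ≃o Hyperfinite 𝒱)
    (r : Cone 𝒱 → OnePoint (Hyperfinite 𝒱 → Hyper 𝒱 ℂ)) :
    ConeSphereSection.shift σ (fun u => (r u).map (Germ.ofFun : _ → Fibre 𝒱 u.1)) =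
      fun u : Cone 𝒱 => ((r (u.shift σ)).map fun x => x ∘ σ).map (Germ.ofFun : _ → Fibre 𝒱 u.1) := by
  funext u
  simp only [ConeSphereSection.shift]
  cases r (u.shift σ) <;> rfl

theorem ConeSphereSection.shift_one {𝒱 : Ultrafilter ℕ} (f : ConeSphereSection 𝒱) :
    f.shift 1 = f := by
  obtain ⟨r, rfl⟩ := f.exists_rep
  rw [ConeSphereSection.shift_rep]
  funext u
  rw [Cone.shift_one]
  cases r u <;> rfl

theorem ConeSphereSection.shift_mul {𝒱 : Ultrafilter ℕ}
    (σ τ : Hyperfinite 𝒱 ≃o Hyperfinite 𝒱) (f : ConeSphereSection 𝒱) :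
    f.shift (σ * τ) = (f.shift σ).shift τ := by
  obtain ⟨r, rfl⟩ := f.exists_rep
  rw [ConeSphereSection.shift_rep, ConeSphereSection.shift_rep,
    ConeSphereSection.shift_rep τ (fun u => (r (u.shift σ)).map fun x => x ∘ σ)]
  funext u
  rw [Cone.shift_mul]
  cases r ((u.shift τ).shift σ) <;> rfl

theorem ConeSection.toSphere_shift {𝒱 : Ultrafilter ℕ} (σ : Hyperfinite 𝒱 ≃o Hyperfinite 𝒱)
    (f : ConeSection 𝒱) : (f.shift σ).toSphere = f.toSphere.shift σ := rfl

theorem ConeSection.toSphere_injective {𝒱 : Ultrafilter ℕ} :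
    Function.Injective (ConeSection.toSphere (𝒱 := 𝒱)) := fun _ _ h =>
  funext fun u => OnePoint.coe_injective (congrFun h u)

/-- The orbit relation on cone sphere sections for a group of automorphisms of the index set. -/
def sphereSetoid {𝒱 : Ultrafilter ℕ} (H : Subgroup (Hyperfinite 𝒱 ≃o Hyperfinite 𝒱)) :
    Setoid (ConeSphereSection 𝒱) where
  r f g := ∃ σ ∈ H, f.shift σ = g
  iseqv :=
    { refl := fun f => ⟨1, H.one_mem, f.shift_one⟩
      symm := by
        rintro f _ ⟨σ, hσ, rfl⟩
        exact ⟨σ⁻¹, H.inv_mem hσ, by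
          rw [← ConeSphereSection.shift_mul, mul_inv_cancel, ConeSphereSection.shift_one]⟩
      trans := by
        rintro f _ _ ⟨σ, hσ, rfl⟩ ⟨τ, hτ, rfl⟩
        exact ⟨σ * τ, H.mul_mem hσ hτ, f.shift_mul σ τ⟩ }

/-- The orbit relation on cone sections: `f ~ g` iff `σ · f = g` for some `σ ∈ H`. -/
def sectionSetoid {𝒱 : Ultrafilter ℕ} (H : Subgroup (Hyperfinite 𝒱 ≃o Hyperfinite 𝒱)) :
    Setoid (ConeSection 𝒱) where
  r f g := ∃ σ ∈ H, f.shift σ = g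
  iseqv :=
    { refl := fun f => ⟨1, H.one_mem, ConeSection.toSphere_injective f.toSphere.shift_one⟩
      symm := by
        rintro f _ ⟨σ, hσ, rfl⟩
        refine ⟨σ⁻¹, H.inv_mem hσ, ConeSection.toSphere_injective ?_⟩
        rw [ConeSection.toSphere_shift, ConeSection.toSphere_shift,
          ← ConeSphereSection.shift_mul, mul_inv_cancel, ConeSphereSection.shift_one]
      trans := by
        rintro f _ _ ⟨σ, hσ, rfl⟩ ⟨τ, hτ, rfl⟩
        exact ⟨σ * τ, H.mul_mem hσ hτ,
          ConeSection.toSphere_injective (f.toSphere.shift_mul σ τ)⟩ }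

/-- Cone transversals: cone sections modulo the diagonal action of `*ℤ²`. -/
abbrev ConeTransversal (𝒱 : Ultrafilter ℕ) : Type := Quotient (sectionSetoid (transGroup 𝒱))

/-- Cone transversals of the sphere sheaf modulo the diagonal action of `*ℤ²`. -/
abbrev ConeSphereTransversal (𝒱 : Ultrafilter ℕ) : Type :=
  Quotient (sphereSetoid (transGroup 𝒱))

/-- The classical transversals: cone sections modulo the diagonal actions of `*ℤ²` and
`GL(2, ℤ)`. -/
abbrev ClassTransversal (𝒱 : Ultrafilter ℕ) : Type := Quotient (sectionSetoid (fullGroup 𝒱))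

/-! ### `*`-asymptoticity -/

/-- The nonstandard absolute value `◇ℂ_u → ◇ℝ_u`. -/
def fibreAbs {𝒱 : Ultrafilter ℕ} {u : Ultrafilter (Hyperfinite 𝒱)} (x : Fibre 𝒱 u) :
    Germ (u : Filter (Hyperfinite 𝒱)) (Hyper 𝒱 ℝ) :=
  x.map fun y => y.map fun z => ‖z‖

/-- The relation `f ≃_* g` on cone sections: `|f(u) - g(u)| < ε` in `◇ℝ_u` for every positive
`ε ∈ *ℝ` (seen as a constant net) and every cone ultrafilter `u`. -/
def StarAsymp {𝒱 : Ultrafilter ℕ} (f g : ConeSection 𝒱) : Prop :=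
  ∀ ε : Hyper 𝒱 ℝ, 0 < ε → ∀ u : Cone 𝒱,
    fibreAbs (f u - g u) < (Germ.const ε : Germ (u.1 : Filter (Hyperfinite 𝒱)) (Hyper 𝒱 ℝ))

/-- The relation induced by `≃_*` on classical transversals. -/
def ClassStarAsymp {𝒱 : Ultrafilter ℕ} (x y : ClassTransversal 𝒱) : Prop :=
  ∃ f g : ConeSection 𝒱, Quotient.mk _ f = x ∧ Quotient.mk _ g = y ∧ StarAsymp f g

/-! ### The lattice, the Eisenstein nets, and the Weierstrass net without correction terms -/

/-- The lattice point `m μ + n`. -/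
def latticePoint (μ : ℂ) (v : Z2) : ℂ := (v 0 : ℂ) * μ + (v 1 : ℂ)

theorem latticePoint_add (μ : ℂ) (v w : Z2) :
    latticePoint μ (v + w) = latticePoint μ v + latticePoint μ w := by
  simp [latticePoint]; ring

/-- The homomorphism `*ℤ² → *ℂ`, `(*m, *n) ↦ *m μ + *n`. -/
def starLatticePoint (𝒱 : Ultrafilter ℕ) (μ : ℂ) : Hyper 𝒱 Z2 →+ Hyper 𝒱 ℂ where
  toFun p := p.map (latticePoint μ)
  map_zero' := by
    refine Germ.coe_eq.2 (Eventually.of_forall fun i => ?_)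
    simp [latticePoint]
  map_add' p q := by
    induction p using Germ.inductionOn with | _ p => ?_
    induction q using Germ.inductionOn with | _ q => ?_
    exact Germ.coe_eq.2 (Eventually.of_forall fun i => latticePoint_add μ (p i) (q i))

/-- The nonstandard lattice `*Λ_μ ⊆ *ℂ`. -/
def starLattice (𝒱 : Ultrafilter ℕ) (μ : ℂ) : AddSubgroup (Hyper 𝒱 ℂ) :=
  (starLatticePoint 𝒱 μ).range

/-- The nonstandard torus `*ℂ / *Λ_μ`. -/
abbrev StarTorus (𝒱 : Ultrafilter ℕ) (μ : ℂ) : Type := Hyper 𝒱 ℂ ⧸ starLattice 𝒱 μ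

/-- `G_k(μ)_F = ∑_{(m,n) ∈ F - (0,0)} (m μ + n)^(-2k)` for a finite set `F`. -/
def eisensteinSum (μ : ℂ) (k : ℤ) (S : Finset Z2) : ℂ :=
  ∑ v ∈ S.erase 0, latticePoint μ v ^ (-2 * k)

/-- The section defined by the net of hyperfinite sums `c G_k(μ)_F`. -/
def eisenstein (𝒱 : Ultrafilter ℕ) (μ : ℂ) (c : ℂ) (k : ℤ) : Section 𝒱 :=
  ofNet fun F => F.map fun S => c * eisensteinSum μ k S

/-- The section of `g_1 = G_1`. -/
def g1 (𝒱 : Ultrafilter ℕ) (μ : ℂ) : Section 𝒱 := eisenstein 𝒱 μ 1 1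

/-- The section of `g_2 = 60 G_2`. -/
def g2 (𝒱 : Ultrafilter ℕ) (μ : ℂ) : Section 𝒱 := eisenstein 𝒱 μ 60 2

/-- The section of `g_3 = 140 G_3`. -/
def g3 (𝒱 : Ultrafilter ℕ) (μ : ℂ) : Section 𝒱 := eisenstein 𝒱 μ 140 3

/-- `℘_F(z) = ∑_{(m,n) ∈ F} (z - (m μ + n))^(-2)` for a finite set `F` (no correction terms). -/
def wpSum (μ : ℂ) (S : Finset Z2) (z : ℂ) : ℂ :=
  ∑ v ∈ S, (z - latticePoint μ v) ^ (-2 : ℤ)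

open Classical in
/-- A net of hyperfinite extensions of functions `f S z` having poles at the lattice points indexed
by `S`: the `F`-component at `z ∈ *ℂ` is `∞` if `z = *m μ + *n` for some `(*m, *n) ∈ F`. -/
def polarNet {𝒱 : Ultrafilter ℕ} (μ : ℂ) (f : Finset Z2 → ℂ → ℂ) (z : Hyper 𝒱 ℂ)
    (F : Hyperfinite 𝒱) : OnePoint (Hyper 𝒱 ℂ) :=
  if ∃ p ∈ carrier F, z = starLatticePoint 𝒱 μ p then ∞
  else ((Germ.map₂ f F z : Hyper 𝒱 ℂ) : OnePoint (Hyper 𝒱 ℂ))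

/-- The Weierstrass function without correction terms, `z ↦` the section of the net `℘_F(z)`. -/
def wp {𝒱 : Ultrafilter ℕ} (μ : ℂ) (z : Hyper 𝒱 ℂ) : SphereSection 𝒱 :=
  ofSphereNet (polarNet μ (wpSum μ) z)

/-- Its derivative, `z ↦` the section of the net `(℘_F)'(z)`. -/
def wpDeriv {𝒱 : Ultrafilter ℕ} (μ : ℂ) (z : Hyper 𝒱 ℂ) : SphereSection 𝒱 :=
  ofSphereNet (polarNet μ (fun S => deriv (wpSum μ S)) z)

theorem mem_carrier_translate {𝒱 : Ultrafilter ℕ} (p q : Hyper 𝒱 Z2) (F : Hyperfinite 𝒱) :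
    q ∈ carrier (translate p F) ↔ q - p ∈ carrier F := by
  induction p using Germ.inductionOn with | _ p => ?_
  induction q using Germ.inductionOn with | _ q => ?_
  induction F using Germ.inductionOn with | _ F => ?_
  change (∀ᶠ i in (𝒱 : Filter ℕ), q i ∈ (F i).map (Equiv.addRight (p i)).toEmbedding) ↔
    ∀ᶠ i in (𝒱 : Filter ℕ), q i - p i ∈ F i
  refine eventually_congr (Eventually.of_forall fun i => ?_)
  simp [Finset.mem_map_equiv, sub_eq_add_neg]

theorem wpSum_translate (μ : ℂ) (S : Finset Z2) (v : Z2) (z : ℂ) :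
    wpSum μ (S.map (Equiv.addRight v).toEmbedding) z = wpSum μ S (z - latticePoint μ v) := by
  simp only [wpSum, Finset.sum_map, Equiv.coe_toEmbedding, Equiv.coe_addRight, latticePoint_add]
  refine Finset.sum_congr rfl fun w _ => ?_
  congr 1; ring

theorem deriv_wpSum_translate (μ : ℂ) (S : Finset Z2) (v : Z2) (z : ℂ) :
    deriv (wpSum μ (S.map (Equiv.addRight v).toEmbedding)) z =
      deriv (wpSum μ S) (z - latticePoint μ v) := by
  rw [funext (wpSum_translate μ S v), deriv_comp_sub_const]

theorem polarNet_translate {𝒱 : Ultrafilter ℕ} (μ : ℂ) (f : Finset Z2 → ℂ → ℂ)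
    (hf : ∀ S v z, f (S.map (Equiv.addRight v).toEmbedding) z = f S (z - latticePoint μ v))
    (z : Hyper 𝒱 ℂ) (p : Hyper 𝒱 Z2) (F : Hyperfinite 𝒱) :
    polarNet μ f z (translate p F) = polarNet μ f (z - starLatticePoint 𝒱 μ p) F := by
  have h1 : (∃ q ∈ carrier (translate p F), z = starLatticePoint 𝒱 μ q) ↔
      ∃ q ∈ carrier F, z - starLatticePoint 𝒱 μ p = starLatticePoint 𝒱 μ q := by
    constructor
    · rintro ⟨q, hq, rfl⟩
      exact ⟨q - p, (mem_carrier_translate p q F).1 hq, (map_sub _ _ _).symm⟩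
    · rintro ⟨q, hq, h⟩
      refine ⟨q + p, (mem_carrier_translate p _ F).2 (by simpa using hq), ?_⟩
      rw [map_add, ← h, sub_add_cancel]
  have h2 : (Germ.map₂ f (translate p F) z : Hyper 𝒱 ℂ) =
      Germ.map₂ f F (z - starLatticePoint 𝒱 μ p) := by
    clear h1
    induction p using Germ.inductionOn with | _ p => ?_
    induction z using Germ.inductionOn with | _ z => ?_
    induction F using Germ.inductionOn with | _ F => ?_
    exact Germ.coe_eq.2 (Eventually.of_forall fun i => hf (F i) (p i) (z i))
  unfold polarNet
  rw [h2]
  by_cases h : ∃ q ∈ carrier F, z - starLatticePoint 𝒱 μ p = starLatticePoint 𝒱 μ q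
  · rw [if_pos h, if_pos (h1.2 h)]
  · rw [if_neg h, if_neg (mt h1.1 h)]

theorem ofSphereNet_shift {𝒱 : Ultrafilter ℕ} (x : Hyperfinite 𝒱 → OnePoint (Hyper 𝒱 ℂ))
    (σ : Hyperfinite 𝒱 ≃o Hyperfinite 𝒱) :
    (ofSphereNet x).restrict.shift σ = (ofSphereNet fun F => x (σ F)).restrict := by
  funext u
  by_cases h : ∀ᶠ F in (u.1 : Filter (Hyperfinite 𝒱)), x (σ F) = ∞
  · have h' : ∀ᶠ F in ((u.shift σ).1 : Filter (Hyperfinite 𝒱)), x F = ∞ := h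
    simp [ConeSphereSection.shift, SphereSection.restrict, ofSphereNet, h, h']
  · have h' : ¬ ∀ᶠ F in ((u.shift σ).1 : Filter (Hyperfinite 𝒱)), x F = ∞ := h
    simp only [ConeSphereSection.shift, SphereSection.restrict, ofSphereNet, h, h', if_false]
    rfl

theorem polarNet_respects {𝒱 : Ultrafilter ℕ} (μ : ℂ) (f : Finset Z2 → ℂ → ℂ)
    (hf : ∀ S v z, f (S.map (Equiv.addRight v).toEmbedding) z = f S (z - latticePoint μ v))
    (z w : Hyper 𝒱 ℂ) (h : (QuotientAddGroup.leftRel (starLattice 𝒱 μ)) z w) :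
    (Quotient.mk _ (ofSphereNet (polarNet μ f z)).restrict : ConeSphereTransversal 𝒱) =
      Quotient.mk _ (ofSphereNet (polarNet μ f w)).restrict := by
  obtain ⟨p, hp⟩ := QuotientAddGroup.leftRel_apply.1 h
  refine Quotient.sound ⟨translate (-p), Subgroup.subset_closure ⟨-p, rfl⟩, ?_⟩
  rw [ofSphereNet_shift]
  congr 2
  funext F
  rw [polarNet_translate μ f hf, map_neg, hp]
  congr 1
  abel

/-- The Weierstrass function on the nonstandard torus, with values in cone transversals. -/
def wpHat {𝒱 : Ultrafilter ℕ} (μ : ℂ) (t : StarTorus 𝒱 μ) : ConeSphereTransversal 𝒱 :=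
  Quotient.liftOn t (fun z => Quotient.mk _ (wp μ z).restrict)
    (polarNet_respects μ _ (wpSum_translate μ))

/-- The derivative of the Weierstrass function on the nonstandard torus, with values in cone
transversals. -/
def wpDerivHat {𝒱 : Ultrafilter ℕ} (μ : ℂ) (t : StarTorus 𝒱 μ) : ConeSphereTransversal 𝒱 :=
  Quotient.liftOn t (fun z => Quotient.mk _ (wpDeriv μ z).restrict)
    (polarNet_respects μ _ (deriv_wpSum_translate μ))

/-! ### The Weierstrass polynomial -/

/-- `E(X,Y) = Y² - 4X³ + 12 g₁X² - (12 g₁² - g₂)X + (4g₁³ - g₁g₂ + g₃)`. -/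
def weierstrassPoly {R : Type} [CommRing R] (g₁ g₂ g₃ X Y : R) : R :=
  Y ^ 2 - 4 * X ^ 3 + 12 * g₁ * X ^ 2 - (12 * g₁ ^ 2 - g₂) * X + (4 * g₁ ^ 3 - g₁ * g₂ + g₃)

/-- The class of a cone section modulo `*ℤ²`. -/
def hat {𝒱 : Ultrafilter ℕ} (f : ConeSection 𝒱) : ConeTransversal 𝒱 := Quotient.mk _ f

/-- The class of a cone sphere section modulo `*ℤ²`. -/
def sphereHat {𝒱 : Ultrafilter ℕ} (f : ConeSphereSection 𝒱) : ConeSphereTransversal 𝒱 :=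
  Quotient.mk _ f

/-- The class of a cone section modulo `*ℤ²` and `GL(2, ℤ)`. -/
def toClass {𝒱 : Ultrafilter ℕ} (f : ConeSection 𝒱) : ClassTransversal 𝒱 := Quotient.mk _ f

/-- The values in the classical transversals of the polynomial `E^class` at `(x̂, ŷ)`. Sections
modulo a group action are multiplied and added through representatives: those of the coefficients
`ĝ_k` and of `x̂`, `ŷ` are chosen independently of each other modulo `*ℤ²`, and are moved by a
common `σ` of the full group. -/
def classValues {𝒱 : Ultrafilter ℕ} (μ : ℂ) (xHat yHat : ConeSphereTransversal 𝒱) :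
    Set (ClassTransversal 𝒱) :=
  {c | ∃ σ ∈ fullGroup 𝒱, ∃ a₁ a₂ a₃ X Y : ConeSection 𝒱,
    hat (a₁.shift σ) = hat (g1 𝒱 μ).restrict ∧
    hat (a₂.shift σ) = hat (g2 𝒱 μ).restrict ∧
    hat (a₃.shift σ) = hat (g3 𝒱 μ).restrict ∧
    sphereHat (X.shift σ).toSphere = xHat ∧
    sphereHat (Y.shift σ).toSphere = yHat ∧
    c = toClass (weierstrassPoly a₁ a₂ a₃ X Y)}

/-- `(x̂, ŷ)` is a solution of `E^class(X, Y) ≃_* 0`: it has finite-valued representatives, so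
that `E^class(x̂, ŷ)` is defined, and every value of `E^class(x̂, ŷ)` is `*`-asymptotic to `0`. -/
def IsClassSolution {𝒱 : Ultrafilter ℕ} (μ : ℂ) (xHat yHat : ConeSphereTransversal 𝒱) : Prop :=
  (classValues μ xHat yHat).Nonempty ∧
    ∀ c ∈ classValues μ xHat yHat, ClassStarAsymp c (toClass 0)

end UltraWeierstrass

end

open UltraWeierstrass

open scoped Topology

namespace UltraWeierstrass

/-! ### The classical limits along finite subsets of the lattice -/

/-! The polynomial is the classical Weierstrass cubic in disguise: `E = Y² - (4(X - g₁)³ - g₂(X -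
g₁) - g₃)`. For a finite set `S` of lattice indices, `X - g₁` over `S` is a partial sum of the
series of `(z - w)⁻² - w⁻²`, which converges unconditionally to `℘(z)`, whereas neither `X` nor `g₁`
is asked to converge separately. Along finite sets `Y`, `g₂`, `g₃` tend to `℘'(z)` and the classical
invariants, so `E` tends to `0` by the differential equation of `℘`.

Representatives modulo `*ℤ²` are chosen independently, so the five arguments are sums over five
different translates of `S`. This does no harm: translation preserves the limit along finite sets,
and `G₁(S + p) - G₁(S)` tends to `0` (`tendsto_eisensteinSum_translate_sub`). Hence
`tendsto_translatedPoly`.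

Such a limit, known for almost every `i`, becomes a nonstandard statement by choosing a threshold
set for each `ε_i`. These sets form a hyperfinite set on whose cone the net is smaller than `ε =
[ε_i]`, and every cone ultrafilter contains that cone (`starAsymp_zero_of_tendsto`). The common `σ`
commutes with `E` and disappears in the quotient. -/

/-- The pair of periods `(μ, 1)`. -/
def periodPair (μ : ℂ) (hμ : μ.im ≠ 0) : PeriodPair where
  ω₁ := μ
  ω₂ := 1
  indep := by
    rw [LinearIndependent.pair_iff]
    intro s t h
    have him := congrArg Complex.im h
    have hs : s = 0 := by simpa [hμ] using him
    subst hs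
    exact ⟨rfl, by simpa using congrArg Complex.re h⟩

theorem latticePoint_injective {μ : ℂ} (hμ : μ.im ≠ 0) :
    Function.Injective (latticePoint μ) := by
  intro v w h
  have him := congrArg Complex.im h
  have h0 : v 0 = w 0 := by simpa [latticePoint, hμ] using him
  have h1 : v 1 = w 1 := by simpa [latticePoint, h0] using h
  funext i
  fin_cases i
  exacts [h0, h1]

theorem latticePoint_mem_lattice {μ : ℂ} (hμ : μ.im ≠ 0) (v : Z2) :
    latticePoint μ v ∈ (periodPair μ hμ).lattice :=
  PeriodPair.mem_lattice.2 ⟨v 0, v 1, by simp [latticePoint, periodPair]⟩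

theorem exists_latticePoint_eq {μ : ℂ} (hμ : μ.im ≠ 0) {z : ℂ}
    (hz : z ∈ (periodPair μ hμ).lattice) : ∃ v, latticePoint μ v = z := by
  obtain ⟨m, n, h⟩ := PeriodPair.mem_lattice.1 hz
  exact ⟨![m, n], by simpa [latticePoint, periodPair] using h⟩

/-- The indexing of the lattice `ℤ μ + ℤ` by `ℤ²`. -/
noncomputable def latticeEquiv {μ : ℂ} (hμ : μ.im ≠ 0) : Z2 ≃ (periodPair μ hμ).lattice :=
  Equiv.ofBijective (fun v => ⟨latticePoint μ v, latticePoint_mem_lattice hμ v⟩)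
    ⟨fun _ _ h => latticePoint_injective hμ (congrArg Subtype.val h),
      fun z => (exists_latticePoint_eq hμ z.2).imp fun _ h => Subtype.ext h⟩

@[simp]
theorem coe_latticeEquiv {μ : ℂ} (hμ : μ.im ≠ 0) (v : Z2) :
    (latticeEquiv hμ v : ℂ) = latticePoint μ v := rfl

@[simp]
theorem latticePoint_zero (μ : ℂ) : latticePoint μ 0 = 0 := by simp [latticePoint]

/-- By the convention `0⁻¹ = 0` the origin contributes nothing, so sums over the whole lattice can
be used. -/
theorem eisensteinSum_eq_sum (μ : ℂ) {k : ℤ} (hk : k ≠ 0) (S : Finset Z2) :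
    eisensteinSum μ k S = ∑ v ∈ S, latticePoint μ v ^ (-2 * k) :=
  Finset.sum_erase _ (by rw [latticePoint_zero, zero_zpow _ (by omega)])

theorem tendsto_eisensteinSum {μ : ℂ} (hμ : μ.im ≠ 0) {k : ℕ} (hk : 1 < k) :
    Tendsto (eisensteinSum μ k) atTop (𝓝 ((periodPair μ hμ).G (2 * k))) := by
  have h := (periodPair μ hμ).hasSum_sumInvPow 0 (r := 2 * k) (by omega)
  rw [PeriodPair.sumInvPow_zero, ← (latticeEquiv hμ).hasSum_iff] at h
  refine h.congr fun S => ?_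
  rw [eisensteinSum_eq_sum μ (by omega)]
  refine Finset.sum_congr rfl fun v _ => ?_
  rw [neg_mul, zpow_neg]
  simp only [Function.comp_apply, coe_latticeEquiv, sub_zero]
  norm_cast

/-- `G₁` collects exactly the correction terms of the series of `℘`. No condition on `z` is needed:
at a lattice point the polar term counts as `0`, and this case is used below. -/
theorem tendsto_wpSum_sub_eisensteinSum {μ : ℂ} (hμ : μ.im ≠ 0) (z : ℂ) :
    Tendsto (fun S => wpSum μ S z - eisensteinSum μ 1 S) atTop
      (𝓝 ((periodPair μ hμ).weierstrassP z)) := by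
  have h := (periodPair μ hμ).hasSum_weierstrassP z
  rw [← (latticeEquiv hμ).hasSum_iff] at h
  refine h.congr fun S => ?_
  rw [eisensteinSum_eq_sum μ one_ne_zero, wpSum, ← Finset.sum_sub_distrib]
  refine Finset.sum_congr rfl fun v _ => ?_
  simp [zpow_neg, zpow_ofNat]

theorem tendsto_map_addRight (p : Z2) :
    Tendsto (fun S : Finset Z2 => S.map (Equiv.addRight p).toEmbedding) atTop atTop := by
  refine tendsto_atTop.2 fun T => eventually_atTop.2
    ⟨T.map (Equiv.addRight (-p)).toEmbedding, fun S hS v hv => ?_⟩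
  rw [Finset.mem_map_equiv]
  exact hS (by rw [Finset.mem_map_equiv]; simpa using hv)

/-- Although `G_1` diverges, it is asymptotically invariant under translations. -/
theorem tendsto_eisensteinSum_translate_sub {μ : ℂ} (hμ : μ.im ≠ 0) (p : Z2) :
    Tendsto (fun S : Finset Z2 => eisensteinSum μ 1 (S.map (Equiv.addRight p).toEmbedding) -
      eisensteinSum μ 1 S) atTop (𝓝 0) := by
  -- At `z = -p` the terms `(-p - w)⁻²` are those of `G₁` over `S + p`. The limit is the
  -- conventional value of `℘` at a lattice point, by periodicity its value at `0`, which is `0`.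
  have h := tendsto_wpSum_sub_eisensteinSum hμ (0 - latticePoint μ p)
  rw [(periodPair μ hμ).weierstrassP_sub_coe 0 ⟨_, latticePoint_mem_lattice hμ p⟩,
    PeriodPair.weierstrassP_zero] at h
  refine h.congr fun S => ?_
  rw [← wpSum_translate, eisensteinSum_eq_sum μ one_ne_zero (S.map _), wpSum]
  congr 1
  refine Finset.sum_congr rfl fun v _ => ?_
  simp [zpow_neg, zpow_ofNat]

theorem tendsto_deriv_wpSum {μ : ℂ} (hμ : μ.im ≠ 0) {z : ℂ}
    (hz : ∀ v, z ≠ latticePoint μ v) :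
    Tendsto (fun S => deriv (wpSum μ S) z) atTop
      (𝓝 ((periodPair μ hμ).derivWeierstrassP z)) := by
  have h := (periodPair μ hμ).hasSum_derivWeierstrassP z
  rw [← (latticeEquiv hμ).hasSum_iff] at h
  refine h.congr fun S => (HasDerivAt.deriv ?_).symm
  refine HasDerivAt.fun_sum fun v _ => ?_
  have hv : z - latticePoint μ v ≠ 0 := sub_ne_zero.2 (hz v)
  convert! (hasDerivAt_zpow (-2) (z - latticePoint μ v) (Or.inl hv)).comp_sub_const
    z (latticePoint μ v) using 1
  simp only [Function.comp_apply, coe_latticeEquiv]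
  rw [show (-2 - 1 : ℤ) = -(3 : ℕ) by norm_num, zpow_neg, zpow_natCast, div_eq_mul_inv]
  norm_num

/-- Apart from `g₂` and `g₃`, only the difference `X - g₁` matters, and this is the quantity that
converges. -/
theorem weierstrassPoly_eq {R : Type} [CommRing R] (g₁ g₂ g₃ X Y : R) :
    weierstrassPoly g₁ g₂ g₃ X Y =
      Y ^ 2 - (4 * (X - g₁) ^ 3 - g₂ * (X - g₁) - g₃) := by
  unfold weierstrassPoly; ring

/-- The value of the Weierstrass polynomial at finite sums over translates of `S`: by `p₁`, `p₂`,
`p₃` in the coefficients, by `q` and `r` in the arguments. -/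
noncomputable def translatedPoly (μ : ℂ) (p₁ p₂ p₃ q r : Z2) (S : Finset Z2) (z : ℂ) : ℂ :=
  weierstrassPoly (1 * eisensteinSum μ 1 (S.map (Equiv.addRight p₁).toEmbedding))
    (60 * eisensteinSum μ 2 (S.map (Equiv.addRight p₂).toEmbedding))
    (140 * eisensteinSum μ 3 (S.map (Equiv.addRight p₃).toEmbedding))
    (wpSum μ (S.map (Equiv.addRight q).toEmbedding) z)
    (deriv (wpSum μ (S.map (Equiv.addRight r).toEmbedding)) z)

theorem tendsto_translatedPoly {μ : ℂ} (hμ : μ.im ≠ 0) (p₁ p₂ p₃ q r : Z2) {z : ℂ}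
    (hz : ∀ v, z ≠ latticePoint μ v) :
    Tendsto (fun S => translatedPoly μ p₁ p₂ p₃ q r S z) atTop (𝓝 0) := by
  set L := periodPair μ hμ
  -- `X - g₁` telescopes: the convergent difference over `S + q`, plus `G₁(S + q) - G₁(S)`, minus
  -- `G₁(S + p₁) - G₁(S)`.
  have hX := ((tendsto_wpSum_sub_eisensteinSum hμ z).comp (tendsto_map_addRight q)).add
    ((tendsto_eisensteinSum_translate_sub hμ q).sub (tendsto_eisensteinSum_translate_sub hμ p₁))
  have hY := (tendsto_deriv_wpSum hμ hz).comp (tendsto_map_addRight r)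
  have h2 := ((tendsto_eisensteinSum hμ (k := 2) (by norm_num)).comp
    (tendsto_map_addRight p₂)).const_mul 60
  have h3 := ((tendsto_eisensteinSum hμ (k := 3) (by norm_num)).comp
    (tendsto_map_addRight p₃)).const_mul 140
  have h := (hY.pow 2).sub ((((hX.pow 3).const_mul 4).sub (h2.mul hX)).sub h3)
  have hzL : z ∉ L.lattice := fun hzL => by
    obtain ⟨v, hv⟩ := exists_latticePoint_eq hμ hzL
    exact hz v hv.symm
  have hL := L.derivWeierstrassP_sq z hzL
  rw [PeriodPair.g₂, PeriodPair.g₃] at hL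
  rw [sub_zero, add_zero, hL, sub_self] at h
  refine h.congr fun S => ?_
  rw [translatedPoly, weierstrassPoly_eq]
  simp only [Function.comp_apply, Nat.cast_ofNat]
  ring

/-! ### Translations and nets -/

theorem translate_mul_translate {𝒱 : Ultrafilter ℕ} (p q : Hyper 𝒱 Z2) :
    translate p * translate q = translate (p + q) := by
  refine RelIso.ext fun F => carrier_injective (Set.ext fun v => ?_)
  change v ∈ carrier (translate p (translate q F)) ↔ _
  rw [mem_carrier_translate, mem_carrier_translate, mem_carrier_translate, sub_sub]

theorem translate_zero {𝒱 : Ultrafilter ℕ} : translate (0 : Hyper 𝒱 Z2) = 1 := by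
  refine RelIso.ext fun F => carrier_injective (Set.ext fun v => ?_)
  rw [mem_carrier_translate, sub_zero]
  rfl

/-- Translations are closed under composition and inverses, so passing to the generated group adds
nothing. -/
theorem exists_eq_translate {𝒱 : Ultrafilter ℕ} {τ : Hyperfinite 𝒱 ≃o Hyperfinite 𝒱}
    (hτ : τ ∈ transGroup 𝒱) : ∃ p, τ = translate p := by
  induction hτ using Subgroup.closure_induction with
  | mem x hx => exact hx.imp fun _ h => h.symm
  | one => exact ⟨0, translate_zero.symm⟩
  | mul x y _ _ hx hy =>
    obtain ⟨p, rfl⟩ := hx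
    obtain ⟨q, rfl⟩ := hy
    exact ⟨p + q, translate_mul_translate p q⟩
  | inv x _ hx =>
    obtain ⟨p, rfl⟩ := hx
    refine ⟨-p, inv_eq_of_mul_eq_one_right ?_⟩
    rw [translate_mul_translate, add_neg_cancel, translate_zero]

theorem ofNet_restrict_shift {𝒱 : Ultrafilter ℕ} (x : Hyperfinite 𝒱 → Hyper 𝒱 ℂ)
    (σ : Hyperfinite 𝒱 ≃o Hyperfinite 𝒱) :
    (ofNet x).restrict.shift σ = (ofNet fun F => x (σ F)).restrict := rfl

/-- The action is diagonal, so a single `p` serves all cone ultrafilters and the representative is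
again given by one net. -/
theorem exists_eq_of_hat_eq_ofNet {𝒱 : Ultrafilter ℕ} {a : ConeSection 𝒱}
    {x : Hyperfinite 𝒱 → Hyper 𝒱 ℂ} (h : hat a = hat (ofNet x).restrict) :
    ∃ p, a = (ofNet fun F => x (translate p F)).restrict := by
  obtain ⟨τ, hτ, rfl⟩ := (sectionSetoid (transGroup 𝒱)).symm (Quotient.exact h)
  obtain ⟨p, rfl⟩ := exists_eq_translate hτ
  exact ⟨p, ofNet_restrict_shift x _⟩

theorem exists_eq_of_sphereHat_eq_ofNet {𝒱 : Ultrafilter ℕ} {X : ConeSection 𝒱}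
    {x : Hyperfinite 𝒱 → Hyper 𝒱 ℂ}
    (h : sphereHat X.toSphere = sphereHat (ofNet x).restrict.toSphere) :
    ∃ p, X = (ofNet fun F => x (translate p F)).restrict := by
  obtain ⟨τ, hτ, h⟩ := (sphereSetoid (transGroup 𝒱)).symm (Quotient.exact h)
  obtain ⟨p, rfl⟩ := exists_eq_translate hτ
  exact ⟨p, (ConeSection.toSphere_injective h).symm⟩

theorem ofSphereNet_coe {𝒱 : Ultrafilter ℕ} (x : Hyperfinite 𝒱 → Hyper 𝒱 ℂ) :
    (ofSphereNet fun F => (x F : OnePoint (Hyper 𝒱 ℂ))).restrict = (ofNet x).restrict.toSphere := by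
  funext u
  simp only [SphereSection.restrict, ofSphereNet, OnePoint.coe_ne_infty, eventually_false_iff_eq_bot,
    u.1.neBot.ne, if_false]
  rfl

theorem ofSphereNet_polarNet {𝒱 : Ultrafilter ℕ} (μ : ℂ) (f : Finset Z2 → ℂ → ℂ)
    {z : Hyper 𝒱 ℂ} (hz : z ∉ starLattice 𝒱 μ) :
    (ofSphereNet (polarNet μ f z)).restrict =
      (ofNet fun F => Germ.map₂ f F z).restrict.toSphere := by
  rw [← ofSphereNet_coe]
  congr 2
  funext F
  exact if_neg fun ⟨p, _, hp⟩ => hz ⟨p, hp.symm⟩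

/-- Otherwise, by the ultrafilter property, almost every `z i` is a lattice point, and the chosen
indices form an element of `*ℤ²` mapping to `z`. -/
theorem eventually_ne_latticePoint {𝒱 : Ultrafilter ℕ} {μ : ℂ} {z : ℕ → ℂ}
    (hz : (z : Hyper 𝒱 ℂ) ∉ starLattice 𝒱 μ) :
    ∀ᶠ i in (𝒱 : Filter ℕ), ∀ v, z i ≠ latticePoint μ v := by
  by_contra hc
  have hc' : ∀ᶠ i in (𝒱 : Filter ℕ), ∃ v, latticePoint μ v = z i :=
    (Ultrafilter.eventually_not.2 hc).mono fun i hi => by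
      push Not at hi
      exact hi.imp fun _ h => h.symm
  obtain ⟨v, hv⟩ := hc'.choice
  exact hz ⟨(v : Hyper 𝒱 Z2), Germ.coe_eq.2 hv⟩

/-! ### Transfer -/

/-- Internal transfer: a sequence of functions with limit `0` along finite sets defines a net
which is eventually smaller than each positive `ε ∈ *ℝ`. -/
theorem eventually_norm_lt {𝒱 : Ultrafilter ℕ} {f : ℕ → Finset Z2 → ℂ}
    (hf : ∀ᶠ i in (𝒱 : Filter ℕ), Tendsto (f i) atTop (𝓝 0)) {ε : Hyper 𝒱 ℝ} (hε : 0 < ε) :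
    ∀ᶠ F : Hyperfinite 𝒱 in atTop,
      (Germ.map₂ (fun (g : Finset Z2 → ℂ) S => ‖g S‖) (f : Hyper 𝒱 (Finset Z2 → ℂ)) F) < ε := by
  induction ε using Germ.inductionOn with | _ ε => ?_
  have h : ∀ᶠ i in (𝒱 : Filter ℕ), ∃ S₀ : Finset Z2, ∀ S, S₀ ≤ S → ‖f i S‖ < ε i := by
    filter_upwards [hf, Germ.coe_lt.1 hε] with i hi hεi
    refine eventually_atTop.1 ((hi.norm).eventually_lt_const ?_)
    rw [norm_zero]
    exact hεi
  -- The thresholds may depend on `i` without any uniformity: their class is still a hyperfinite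
  -- set, the vertex of the required cone.
  obtain ⟨S₀, hS₀⟩ := h.choice
  refine eventually_atTop.2 ⟨(S₀ : Hyperfinite 𝒱), fun F hF => ?_⟩
  induction F using Germ.inductionOn with | _ F => ?_
  exact Germ.coe_lt.2 ((hS₀.and (Germ.coe_le.1 hF)).mono fun i hi => hi.1 _ hi.2)

theorem starAsymp_zero_of_tendsto {𝒱 : Ultrafilter ℕ} {f : ℕ → Finset Z2 → ℂ}
    (hf : ∀ᶠ i in (𝒱 : Filter ℕ), Tendsto (f i) atTop (𝓝 0)) :
    StarAsymp (ofNet fun F => Germ.map₂ (fun g S => g S) (f : Hyper 𝒱 (Finset Z2 → ℂ)) F).restrict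
      0 := by
  intro ε hε u
  have h : ∀ᶠ F in (u.1 : Filter (Hyperfinite 𝒱)), _ := u.2 (eventually_norm_lt hf hε)
  rw [Pi.zero_apply, sub_zero]
  refine Germ.coe_lt.2 (h.mono fun F hF => ?_)
  induction F using Germ.inductionOn with | _ F => ?_
  exact hF

/-- Reindexing nets respects the pointwise ring operations. -/
theorem weierstrassPoly_shift {𝒱 : Ultrafilter ℕ} (σ : Hyperfinite 𝒱 ≃o Hyperfinite 𝒱)
    (a₁ a₂ a₃ X Y : ConeSection 𝒱) :
    (weierstrassPoly a₁ a₂ a₃ X Y).shift σ =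
      weierstrassPoly (a₁.shift σ) (a₂.shift σ) (a₃.shift σ) (X.shift σ) (Y.shift σ) := by
  funext u
  change fibreShift σ u (weierstrassPoly (a₁ (u.shift σ)) (a₂ (u.shift σ)) (a₃ (u.shift σ))
      (X (u.shift σ)) (Y (u.shift σ))) =
    weierstrassPoly (fibreShift σ u (a₁ (u.shift σ))) (fibreShift σ u (a₂ (u.shift σ)))
      (fibreShift σ u (a₃ (u.shift σ))) (fibreShift σ u (X (u.shift σ)))
      (fibreShift σ u (Y (u.shift σ)))
  induction a₁ (u.shift σ) using Germ.inductionOn with | _ a₁ => ?_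
  induction a₂ (u.shift σ) using Germ.inductionOn with | _ a₂ => ?_
  induction a₃ (u.shift σ) using Germ.inductionOn with | _ a₃ => ?_
  induction X (u.shift σ) using Germ.inductionOn with | _ X => ?_
  induction Y (u.shift σ) using Germ.inductionOn with | _ Y => ?_
  rfl

theorem starAsymp_weierstrassPoly {𝒱 : Ultrafilter ℕ} {μ : ℂ} (hμ : μ.im ≠ 0) {z : Hyper 𝒱 ℂ}
    (hz : z ∉ starLattice 𝒱 μ) (p₁ p₂ p₃ q r : Hyper 𝒱 Z2) :
    StarAsymp (weierstrassPoly
      (ofNet fun F => (translate p₁ F).map fun S => 1 * eisensteinSum μ 1 S).restrict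
      (ofNet fun F => (translate p₂ F).map fun S => 60 * eisensteinSum μ 2 S).restrict
      (ofNet fun F => (translate p₃ F).map fun S => 140 * eisensteinSum μ 3 S).restrict
      (ofNet fun F => Germ.map₂ (wpSum μ) (translate q F) z).restrict
      (ofNet fun F => Germ.map₂ (fun S => deriv (wpSum μ S)) (translate r F) z).restrict) 0 := by
  induction z using Germ.inductionOn with | _ z => ?_
  induction p₁ using Germ.inductionOn with | _ p₁ => ?_
  induction p₂ using Germ.inductionOn with | _ p₂ => ?_
  induction p₃ using Germ.inductionOn with | _ p₃ => ?_
  induction q using Germ.inductionOn with | _ q => ?_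
  induction r using Germ.inductionOn with | _ r => ?_
  -- The five translations are internal, so the section is the ultraproduct of the standard nets
  -- with parameters `p₁ i`, …, `r i`, `z i`.
  convert! starAsymp_zero_of_tendsto (𝒱 := 𝒱)
    (f := fun i S => translatedPoly μ (p₁ i) (p₂ i) (p₃ i) (q i) (r i) S (z i))
    ((eventually_ne_latticePoint hz).mono fun i hi => tendsto_translatedPoly hμ _ _ _ _ _ hi) using 1
  funext u
  refine Germ.coe_eq.2 (Eventually.of_forall fun F => ?_)
  induction F using Germ.inductionOn with | _ F => ?_
  rfl

end UltraWeierstrass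

theorem theorem4 (𝒱 : Ultrafilter ℕ) (h𝒱 : (𝒱 : Filter ℕ) ≤ Filter.cofinite)
    (μ : ℂ) (hμ : μ.im ≠ 0) (t : StarTorus 𝒱 μ) (ht : t ≠ 0) :
    IsClassSolution μ (wpHat μ t) (wpDerivHat μ t) := by
  induction t using QuotientAddGroup.induction_on with | _ z => ?_
  have hz : z ∉ starLattice 𝒱 μ := fun h => ht ((QuotientAddGroup.eq_zero_iff z).2 h)
  have hX : wpHat μ (z : StarTorus 𝒱 μ) =
      sphereHat (ofNet fun F => Germ.map₂ (wpSum μ) F z).restrict.toSphere :=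
    congrArg sphereHat (ofSphereNet_polarNet μ _ hz)
  have hY : wpDerivHat μ (z : StarTorus 𝒱 μ) = sphereHat
      (ofNet fun F => Germ.map₂ (fun S => deriv (wpSum μ S)) F z).restrict.toSphere :=
    congrArg sphereHat (ofSphereNet_polarNet μ _ hz)
  rw [hX, hY]
  constructor
  · exact ⟨_, 1, Subgroup.one_mem _, (g1 𝒱 μ).restrict, (g2 𝒱 μ).restrict, (g3 𝒱 μ).restrict,
      (ofNet fun F => Germ.map₂ (wpSum μ) F z).restrict,
      (ofNet fun F => Germ.map₂ (fun S => deriv (wpSum μ S)) F z).restrict,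
      rfl, rfl, rfl, rfl, rfl, rfl⟩
  · rintro c ⟨σ, hσ, a₁, a₂, a₃, X, Y, h₁, h₂, h₃, hX, hY, rfl⟩
    obtain ⟨p₁, h₁⟩ := exists_eq_of_hat_eq_ofNet h₁
    obtain ⟨p₂, h₂⟩ := exists_eq_of_hat_eq_ofNet h₂
    obtain ⟨p₃, h₃⟩ := exists_eq_of_hat_eq_ofNet h₃
    obtain ⟨q, hX⟩ := exists_eq_of_sphereHat_eq_ofNet hX
    obtain ⟨r, hY⟩ := exists_eq_of_sphereHat_eq_ofNet hY
    -- The representative moved by `σ` has the same class and is a polynomial in translated nets.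
    refine ⟨(weierstrassPoly a₁ a₂ a₃ X Y).shift σ, 0, ?_, rfl, ?_⟩
    · exact (Quotient.sound ⟨σ, hσ, rfl⟩ : toClass (weierstrassPoly a₁ a₂ a₃ X Y) = _).symm
    · rw [weierstrassPoly_shift, h₁, h₂, h₃, hX, hY]
      exact starAsymp_weierstrassPoly hμ hz p₁ p₂ p₃ q r
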